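/- **Setting.** Let $\Sigma$ be a finite set of events, $\checkmark,\tau\notin\Sigma$; $a\in\Sigma$, $A\subseteq\Sigma$, $R\subseteq\Sigma\times\Sigma$, and process variables $X,Y$ are drawn from a fixed infinite set. CSP terms are $$P ::= \mathrm{STOP}\mid a\to P\mid \mathrm{SKIP}\mid P_1\sqcap P_2\mid P_1\mathbin{\square} P_2\mid P_1\parallel_A P_2\mid P_1;P_2\mid P\setminus A\mid P[R]\mid X\mid \mu X.P\mid \mathrm{DIV}.$$ A term is closed (a process) if it has no free variable, and open otherwise. Write $R(U)=\{y:\exists x\in U,\ xRy\}$, $R^{-1}(U)=\{x:\exists y\in U,\ xRy\}$, and $\mathcal P$ for power set. *Transitions* $P\xrightarrow{\gamma}P'$, $\gamma\in\Sigma\cup\{\checkmark,\tau\}$, are generated by: $(a\to P)\xrightarrow{a}P$; $\mathrm{SKIP}\xrightarrow{\checkmark}\mathrm{STOP}$; $P_1\sqcap P_2\xrightarrow{\tau}P_i$; in $P_1\mathbin\square P_2$ a $\tau$-step of a component keeps the choice, a visible step (in $\Sigma\cup\{\checkmark\}$) of a component resolves it; in $P_1\parallel_A P_2$ the components synchronise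 on $A\cup\{\checkmark\}$ and otherwise move independently; $P_1;P_2\xrightarrow{\tau}P_2$ if $P_1\xrightarrow{\checkmark}P_1'$, and $P_1;P_2\xrightarrow{\gamma}P_1';P_2$ if $P_1\xrightarrow{\gamma}P_1'$, $\gamma\ne\checkmark$; in $P\setminus A$ the events of $A$ become $\tau$, the other labels are kept; in $P[R]$ a step labelled $a$ yields a step labelled $b$ for every $b$ with $aRb$, while $\tau$ and $\checkmark$ are kept; $\mu X.P\xrightarrow{\tau}P[\mu X.P/X]$; $\mathrm{DIV}\xrightarrow{\tau}\mathrm{DIV}$. A process *can diverge* if from some reachable state there is an infinite path of $\tau$-steps. **General analysis.** $N_X(P),C_X(P),F(P)\subseteq\mathcal P(\Sigma)^2$ and $G(P)\subseteq\mathcal P(\Sigma)$ are defined by recursion on DIV-free terms $P$. $N_X(P)=\mathcal P(\Sigma)^2$ if $X$ is not free in $P$; otherwise $N_X(a\to P)=N_X(P)$; $N_X(P_1\oplus P_2)=N_X(P_1)\cap N_X(P_2)$ for $\oplus\in\{\sqcap,\square,;,\parallel_A\}$; $N_X(P\setminus A)=\{(U,V):\exists V'\subseteq V,\ (U,V')\in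 N_X(P),\ V'\cap A=\emptyset\}$; $N_X(P[R])=\{(U,V):\exists V',\ (U,V')\in N_X(P),\ R(V')\subseteq V\}$; $N_X(X)=\{(U,V):U\subseteq V\}$; $N_X(\mu Y.P)=\{(U,V):\exists U'\supseteq U,\ V'\subseteq V,\ (U',V')\in N_X(P),\ (V',V')\in N_Y(P)\}$. $G(\mathrm{STOP})=\mathcal P(\Sigma)$; $G(a\to P)=G(P)\cup\{V:a\in V\}$; $G(\mathrm{SKIP})=G(X)=\emptyset$; $G(P_1\oplus P_2)=G(P_1)\cap G(P_2)$ for $\oplus\in\{\sqcap,\square\}$; $G(P_1;P_2)=G(P_1)\cup G(P_2)$ if $P_1$ is closed and $F(P_1)\ne\emptyset$, and $G(P_1)$ otherwise; $G(P_1\parallel_A P_2)=G(P_1)\cup G(P_2)$ if both $P_i$ are closed with $F(P_i)\neq\emptyset$, and $G(P_1)\cap G(P_2)$ otherwise; $G(P\setminus A)=\{V:\exists V'\in G(P),\ V'\cap A=\emptyset,\ V'\subseteq V\}$ if $P$ is closed and $(\emptyset,\Sigma-A)\in F(P)$, and $\emptyset$ otherwise; $G(P[R])=\{V:\exists V'\in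 G(P),\ R(V')\subseteq V\}$; $G(\mu X.P)=G(P)$. $C_X(P)=\mathcal P(\Sigma)^2$ if $X$ is not free in $P$; otherwise $C_X(a\to P)=C_X(P)\cup\{(U,V)\in N_X(P):a\in V\}$; $C_X(P_1\oplus P_2)=C_X(P_1)\cap C_X(P_2)$ for $\oplus\in\{\sqcap,\square,\parallel_A\}$; $C_X(P_1;P_2)=C_X(P_1)\cap\bigl(C_X(P_2)\cup\{(U,V)\in N_X(P_2):V\in G(P_1)\}\bigr)$; $C_X(P\setminus A)$, $C_X(P[R])$ as for $N_X$ with $C_X(P)$ in place of $N_X(P)$; $C_X(X)=\emptyset$; $C_X(\mu Y.P)=\{(U,V):\exists U'\supseteq U,\ V'\subseteq V,\ (U',V')\in C_X(P),\ (V',V')\in N_Y(P)\}$. $F(\mathrm{STOP})=F(\mathrm{SKIP})=\mathcal P(\Sigma)^2$; $F(a\to P)=F(P)$; $F(P_1\oplus P_2)=F(P_1)\cap F(P_2)$ for $\oplus\in\{\sqcap,\square,;\}$; $F(P_1\parallel_A P_2)=(F(P_1)\cap F(P_2))\cup\{(U_1\cap U_2,V_1):(U_1,V_1)\in F(P_1),(U_2,A)\in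 F(P_2)\}\cup\{(U_1\cap U_2,V_2):(U_2,V_2)\in F(P_2),(U_1,A)\in F(P_1)\}$; $F(P\setminus A)$, $F(P[R])$ as for $N_X$ with $F(P)$ in place of $N_X(P)$; $F(X)=\{(U,V):U\subseteq V\}$; $F(\mu X.P)=\{(U,V):\exists W,\ (W,W)\in C_X(P)\cap F(P),\ W\subseteq V\}$ if $\mu X.P$ is closed, and the same set with the extra condition $U\subseteq W$ if it is open. **Structurally finite-state (SFS) processes.** $\mathrm{STOP}$, $\mathrm{SKIP}$, $X$ are sequential; if $P,Q$ are sequential, so are $a\to P$, $P\sqcap Q$, $P\mathbin\square Q$, $\mu X.P$; and if in addition $P$ is closed, so are $P;Q$, $P\setminus A$, $P[R]$. Every closed sequential term is SFS; and if $P,Q$ are SFS, so are $a\to P$, $P\sqcap Q$, $P\mathbin\square Q$, $P\parallel_A Q$, $P;Q$, $P\setminus A$, $P[R]$. **SFS analysis.** For an SFS process $P$, the flag $\delta(P)\in\{\mathrm{true},\mathrm{false}\}$ and the set $\Phi(P)\subseteq\mathcal P(\Sigma)^2$ are defined as follows. If $P$ is sequential, then $\delta(P)=\mathrm{true}$ iff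 $P$ can diverge, and $\Phi(P)$ is the set of all $(L,\Sigma-L)$ with $L\neq\emptyset$ such that the transition system of $P$ has an infinite trace $u\in\Sigma^\omega$ in which each event of $L$ occurs infinitely often and each event of $\Sigma-L$ only finitely often. Otherwise: - $\delta(a\to P)=\delta(P[R])=\delta(P)$ and $\delta(P_1\oplus P_2)=\delta(P_1)\vee\delta(P_2)$ for $\oplus\in\{\sqcap,\square,\parallel_A,;\}$; $\delta(P\setminus A)=\mathrm{false}$ if $\delta(P)=\mathrm{false}$ and $F-A\neq\emptyset$ for each $(F,C)\in\Phi(P)$, and $\delta(P\setminus A)=\mathrm{true}$ otherwise; - $\Phi(a\to P)=\Phi(P)$; $\Phi(P_1\oplus P_2)=\Phi(P_1)\cup\Phi(P_2)$ for $\oplus\in\{\sqcap,\square,;\}$; - $\Phi(P_1\parallel_A P_2)$ consists of all $(F,C)$ with $F\cap C=\emptyset$, $F=F_1\cup F_2$, $C=(C_1\cap A)\cup(C_2\cap A)\cup((C_1-A)\cap(C_2-A))$ for some $(F_i,C_i)\in\Phi(P_i)$, and of all $(F,C)\in\Phi(P_1)\cup\Phi(P_2)$ with $F\cap A=\emptyset$;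 - $\Phi(P\setminus A)=\{(F-A,C\cup A):(F,C)\in\Phi(P)\}$; - $\Phi(P[R])$ is the set of all $(F,C)$ such that, for some $(F',C')\in\Phi(P)$, $F'\subseteq R^{-1}(F)$, $F\subseteq R(F')$ and $C=\{b\in\Sigma:R^{-1}(\{b\})\subseteq C'\}$. **Proposition.** For every structurally finite-state process $P$, if $F(P)\neq\emptyset$ then $\delta(P)=\mathrm{false}$. (So the SFS analysis accepts every SFS process that the general analysis accepts.) -/

import Mathlib

namespace CSP

/-- CSP terms over an alphabet `α` of events (open and closed); process variables are drawn from
the infinite set `ℕ`. -/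
inductive Term (α : Type*) where
  | STOP : Term α
  | pre (a : α) (P : Term α) : Term α
  | SKIP : Term α
  | intChoice (P₁ P₂ : Term α) : Term α
  | extChoice (P₁ P₂ : Term α) : Term α
  | par (A : Set α) (P₁ P₂ : Term α) : Term α
  | seq (P₁ P₂ : Term α) : Term α
  | hide (P : Term α) (A : Set α) : Term α
  | rename (P : Term α) (R : α → α → Prop) : Term α
  | var (X : ℕ) : Term α
  | mu (X : ℕ) (P : Term α) : Term α
  | DIV : Term α

/-- Labels of transitions: an event, successful termination, or the silent action. -/
inductive Label (α : Type*) where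
  | ev (a : α) : Label α
  | tick : Label α
  | tau : Label α

/-- `γ ∈ A ∪ {✓}`. -/
def Label.InTick {α : Type*} (A : Set α) : Label α → Prop
  | .ev a => a ∈ A
  | .tick => True
  | .tau => False

/-- The lifting of a renaming relation to `Σ ∪ {✓}`, relating `✓` to itself only. -/
inductive LiftRel {α : Type*} (R : α → α → Prop) : Label α → Label α → Prop where
  | ev {a b : α} (h : R a b) : LiftRel R (.ev a) (.ev b)
  | tick : LiftRel R .tick .tick

/-- `R(U)`, the set of all `R`-successors of elements of `U`. -/
def relImage {α : Type*} (R : α → α → Prop) (U : Set α) : Set α :=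
  {y | ∃ x ∈ U, R x y}

/-- `R⁻¹(U)`, the set of all `R`-predecessors of elements of `U`. -/
def relPreimage {α : Type*} (R : α → α → Prop) (U : Set α) : Set α :=
  {x | ∃ y ∈ U, R x y}

namespace Term

/-- The set of free variables of a term. -/
def fv {α : Type*} : Term α → Set ℕ
  | STOP => ∅
  | pre _ P => fv P
  | SKIP => ∅
  | intChoice P₁ P₂ => fv P₁ ∪ fv P₂
  | extChoice P₁ P₂ => fv P₁ ∪ fv P₂
  | par _ P₁ P₂ => fv P₁ ∪ fv P₂
  | seq P₁ P₂ => fv P₁ ∪ fv P₂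
  | hide P _ => fv P
  | rename P _ => fv P
  | var X => {X}
  | mu X P => fv P \ {X}
  | DIV => ∅

/-- A term is closed (a process) if it has no free variable. -/
def Closed {α : Type*} (P : Term α) : Prop := P.fv = ∅

/-- `subst X Q P` is `[Q/X]P`: every free occurrence of `X` in `P` is replaced by `Q`. In the
operational semantics of processes, `Q` is always closed, so that no variable can be captured. -/
def subst {α : Type*} (X : ℕ) (Q : Term α) : Term α → Term α
  | STOP => STOP
  | pre a P => pre a (subst X Q P)
  | SKIP => SKIP
  | intChoice P₁ P₂ => intChoice (subst X Q P₁) (subst X Q P₂)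
  | extChoice P₁ P₂ => extChoice (subst X Q P₁) (subst X Q P₂)
  | par A P₁ P₂ => par A (subst X Q P₁) (subst X Q P₂)
  | seq P₁ P₂ => seq (subst X Q P₁) (subst X Q P₂)
  | hide P A => hide (subst X Q P) A
  | rename P R => rename (subst X Q P) R
  | var Y => if Y = X then Q else var Y
  | mu Y P => if Y = X then mu Y P else mu Y (subst X Q P)
  | DIV => DIV

/-! ### Operational semantics -/

/-- `Step P γ P'`: the process `P` can perform a `γ`-transition and become `P'`. -/
inductive Step {α : Type*} : Term α → Label α → Term α → Prop where
  | pre (a : α) (P : Term α) : Step (pre a P) (.ev a) P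
  | SKIP : Step SKIP .tick STOP
  | intChoiceL (P₁ P₂ : Term α) : Step (intChoice P₁ P₂) .tau P₁
  | intChoiceR (P₁ P₂ : Term α) : Step (intChoice P₁ P₂) .tau P₂
  | extChoiceTauL {P₁ P₁' P₂ : Term α} (h : Step P₁ .tau P₁') :
      Step (extChoice P₁ P₂) .tau (extChoice P₁' P₂)
  | extChoiceTauR {P₁ P₂ P₂' : Term α} (h : Step P₂ .tau P₂') :
      Step (extChoice P₁ P₂) .tau (extChoice P₁ P₂')
  | extChoiceL {γ : Label α} {P₁ P₁' P₂ : Term α} (hγ : γ ≠ .tau) (h : Step P₁ γ P₁') :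
      Step (extChoice P₁ P₂) γ P₁'
  | extChoiceR {γ : Label α} {P₁ P₂ P₂' : Term α} (hγ : γ ≠ .tau) (h : Step P₂ γ P₂') :
      Step (extChoice P₁ P₂) γ P₂'
  | parL {A : Set α} {γ : Label α} {P₁ P₁' P₂ : Term α} (hγ : ¬ γ.InTick A)
      (h : Step P₁ γ P₁') : Step (par A P₁ P₂) γ (par A P₁' P₂)
  | parR {A : Set α} {γ : Label α} {P₁ P₂ P₂' : Term α} (hγ : ¬ γ.InTick A)
      (h : Step P₂ γ P₂') : Step (par A P₁ P₂) γ (par A P₁ P₂')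
  | parSync {A : Set α} {γ : Label α} {P₁ P₁' P₂ P₂' : Term α} (hγ : γ.InTick A)
      (h₁ : Step P₁ γ P₁') (h₂ : Step P₂ γ P₂') : Step (par A P₁ P₂) γ (par A P₁' P₂')
  | seqTick {P₁ P₁' P₂ : Term α} (h : Step P₁ .tick P₁') : Step (seq P₁ P₂) .tau P₂
  | seqL {γ : Label α} {P₁ P₁' P₂ : Term α} (hγ : γ ≠ .tick) (h : Step P₁ γ P₁') :
      Step (seq P₁ P₂) γ (seq P₁' P₂)
  | hideIn {A : Set α} {a : α} {P P' : Term α} (ha : a ∈ A) (h : Step P (.ev a) P') :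
      Step (hide P A) .tau (hide P' A)
  | hideOut {A : Set α} {γ : Label α} {P P' : Term α} (hγ : ∀ a ∈ A, γ ≠ .ev a)
      (h : Step P γ P') : Step (hide P A) γ (hide P' A)
  | renameTau {R : α → α → Prop} {P P' : Term α} (h : Step P .tau P') :
      Step (rename P R) .tau (rename P' R)
  | rename {R : α → α → Prop} {γ γ' : Label α} {P P' : Term α} (hR : LiftRel R γ γ')
      (h : Step P γ P') : Step (rename P R) γ' (rename P' R)
  | mu (X : ℕ) (P : Term α) : Step (mu X P) .tau (subst X (mu X P) P)
  | DIV : Step DIV .tau DIV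

/-- `P` has an infinite path consisting of silent actions only. -/
def Diverges {α : Type*} (P : Term α) : Prop :=
  ∃ s : ℕ → Term α, s 0 = P ∧ ∀ n, Step (s n) .tau (s (n + 1))

/-- `Q` is a state of the labelled transition system of `P`, all of whose states are reachable. -/
def Reachable {α : Type*} (P Q : Term α) : Prop :=
  Relation.ReflTransGen (fun S S' => ∃ γ, Step S γ S') P Q

/-- `P` can eventually diverge. -/
def CanDiverge {α : Type*} (P : Term α) : Prop :=
  ∃ Q, Reachable P Q ∧ Diverges Q

/-- `WeakStep P a Q`: finitely many silent actions followed by the event `a` lead from `P` to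
`Q`. -/
def WeakStep {α : Type*} (P : Term α) (a : α) (Q : Term α) : Prop :=
  ∃ S, Relation.ReflTransGen (fun S S' => Step S .tau S') P S ∧ Step S (.ev a) Q

/-- `u` is the sequence of visible events along some infinite path of the labelled transition
system of `P`. -/
def InfTrace {α : Type*} (P : Term α) (u : ℕ → α) : Prop :=
  ∃ s : ℕ → Term α, s 0 = P ∧ ∀ n, WeakStep (s n) (u n) (s (n + 1))

/-! ### The general analysis -/

open Classical in
/-- The nonexpansive sets `N_X(P)`. -/
noncomputable def nonexp {α : Type*} (X : ℕ) : Term α → Set (Set α × Set α)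
  | STOP => Set.univ
  | pre a P => if X ∈ (pre a P).fv then nonexp X P else Set.univ
  | SKIP => Set.univ
  | intChoice P₁ P₂ =>
      if X ∈ (intChoice P₁ P₂).fv then nonexp X P₁ ∩ nonexp X P₂ else Set.univ
  | extChoice P₁ P₂ =>
      if X ∈ (extChoice P₁ P₂).fv then nonexp X P₁ ∩ nonexp X P₂ else Set.univ
  | par A P₁ P₂ =>
      if X ∈ (par A P₁ P₂).fv then nonexp X P₁ ∩ nonexp X P₂ else Set.univ
  | seq P₁ P₂ =>
      if X ∈ (seq P₁ P₂).fv then nonexp X P₁ ∩ nonexp X P₂ else Set.univ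
  | hide P A =>
      if X ∈ (hide P A).fv then
        {p | ∃ V', (p.1, V') ∈ nonexp X P ∧ V' ∩ A = ∅ ∧ V' ⊆ p.2}
      else Set.univ
  | rename P R =>
      if X ∈ (rename P R).fv then
        {p | ∃ V', (p.1, V') ∈ nonexp X P ∧ relImage R V' ⊆ p.2}
      else Set.univ
  | var Y => if X ∈ (var Y : Term α).fv then {p | p.1 ⊆ p.2} else Set.univ
  | mu Y P =>
      if X ∈ (mu Y P).fv then
        {p | ∃ U' V', (U', V') ∈ nonexp X P ∧ (V', V') ∈ nonexp Y P ∧ p.1 ⊆ U' ∧ V' ⊆ p.2}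
      else Set.univ
  | DIV => Set.univ

open Classical in
mutual

/-- The guard sets `G(P)`. -/
noncomputable def guards {α : Type*} : Term α → Set (Set α)
  | STOP => Set.univ
  | pre a P => guards P ∪ {V | a ∈ V}
  | SKIP => ∅
  | intChoice P₁ P₂ => guards P₁ ∩ guards P₂
  | extChoice P₁ P₂ => guards P₁ ∩ guards P₂
  | par _ P₁ P₂ =>
      if (P₁.Closed ∧ (fairSets P₁).Nonempty) ∧ (P₂.Closed ∧ (fairSets P₂).Nonempty) then
        guards P₁ ∪ guards P₂
      else guards P₁ ∩ guards P₂
  | seq P₁ P₂ =>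
      if P₁.Closed ∧ (fairSets P₁).Nonempty then guards P₁ ∪ guards P₂ else guards P₁
  | hide P A =>
      if P.Closed ∧ (∅, Aᶜ) ∈ fairSets P then
        {V | ∃ V' ∈ guards P, V' ∩ A = ∅ ∧ V' ⊆ V}
      else ∅
  | rename P R => {V | ∃ V' ∈ guards P, relImage R V' ⊆ V}
  | var _ => ∅
  | mu _ P => guards P
  -- the analysis is not applied to terms that contain `DIV`; the safe value is chosen
  | DIV => ∅

/-- The contractive sets `C_X(P)`. -/
noncomputable def contr {α : Type*} (X : ℕ) : Term α → Set (Set α × Set α)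
  | STOP => Set.univ
  | pre a P =>
      if X ∈ (pre a P).fv then
        contr X P ∪ {p | p ∈ nonexp X P ∧ a ∈ p.2}
      else Set.univ
  | SKIP => Set.univ
  | intChoice P₁ P₂ =>
      if X ∈ (intChoice P₁ P₂).fv then contr X P₁ ∩ contr X P₂ else Set.univ
  | extChoice P₁ P₂ =>
      if X ∈ (extChoice P₁ P₂).fv then contr X P₁ ∩ contr X P₂ else Set.univ
  | par A P₁ P₂ =>
      if X ∈ (par A P₁ P₂).fv then contr X P₁ ∩ contr X P₂ else Set.univ
  | seq P₁ P₂ =>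
      if X ∈ (seq P₁ P₂).fv then
        contr X P₁ ∩ (contr X P₂ ∪ {p | p ∈ nonexp X P₂ ∧ p.2 ∈ guards P₁})
      else Set.univ
  | hide P A =>
      if X ∈ (hide P A).fv then
        {p | ∃ V', (p.1, V') ∈ contr X P ∧ V' ∩ A = ∅ ∧ V' ⊆ p.2}
      else Set.univ
  | rename P R =>
      if X ∈ (rename P R).fv then
        {p | ∃ V', (p.1, V') ∈ contr X P ∧ relImage R V' ⊆ p.2}
      else Set.univ
  | var Y => if X ∈ (var Y : Term α).fv then ∅ else Set.univ
  | mu Y P =>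
      if X ∈ (mu Y P).fv then
        {p | ∃ U' V', (U', V') ∈ contr X P ∧ (V', V') ∈ nonexp Y P ∧ p.1 ⊆ U' ∧ V' ⊆ p.2}
      else Set.univ
  | DIV => Set.univ

/-- The fair sets `F(P)`. -/
noncomputable def fairSets {α : Type*} : Term α → Set (Set α × Set α)
  | STOP => Set.univ
  | pre _ P => fairSets P
  | SKIP => Set.univ
  | intChoice P₁ P₂ => fairSets P₁ ∩ fairSets P₂
  | extChoice P₁ P₂ => fairSets P₁ ∩ fairSets P₂
  | par A P₁ P₂ =>
      (fairSets P₁ ∩ fairSets P₂) ∪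
      {p | ∃ U₁ U₂ V₁, (U₁, V₁) ∈ fairSets P₁ ∧ (U₂, A) ∈ fairSets P₂ ∧ p = (U₁ ∩ U₂, V₁)} ∪
      {p | ∃ U₁ U₂ V₂, (U₂, V₂) ∈ fairSets P₂ ∧ (U₁, A) ∈ fairSets P₁ ∧ p = (U₁ ∩ U₂, V₂)}
  | seq P₁ P₂ => fairSets P₁ ∩ fairSets P₂
  | hide P A => {p | ∃ V', (p.1, V') ∈ fairSets P ∧ V' ∩ A = ∅ ∧ V' ⊆ p.2}
  | rename P R => {p | ∃ V', (p.1, V') ∈ fairSets P ∧ relImage R V' ⊆ p.2}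
  | var _ => {p | p.1 ⊆ p.2}
  | mu X P =>
      if (mu X P).Closed then
        {p | ∃ W, (W, W) ∈ contr X P ∩ fairSets P ∧ W ⊆ p.2}
      else
        {p | ∃ W, (W, W) ∈ contr X P ∩ fairSets P ∧ p.1 ⊆ W ∧ W ⊆ p.2}
  -- the analysis is not applied to terms that contain `DIV`; the safe value is chosen
  | DIV => ∅

end

/-! ### Structurally finite-state processes -/

/-- Sequential terms. -/
inductive Sequential {α : Type*} : Term α → Prop where
  | STOP : Sequential STOP
  | SKIP : Sequential SKIP
  | var (X : ℕ) : Sequential (var X)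
  | pre (a : α) {P : Term α} (hP : Sequential P) : Sequential (pre a P)
  | intChoice {P Q : Term α} (hP : Sequential P) (hQ : Sequential Q) :
      Sequential (intChoice P Q)
  | extChoice {P Q : Term α} (hP : Sequential P) (hQ : Sequential Q) :
      Sequential (extChoice P Q)
  | mu (X : ℕ) {P : Term α} (hP : Sequential P) : Sequential (mu X P)
  | seq {P Q : Term α} (hP : Sequential P) (hPc : P.Closed) (hQ : Sequential Q) :
      Sequential (seq P Q)
  | hide {P : Term α} (hP : Sequential P) (hPc : P.Closed) (A : Set α) : Sequential (hide P A)
  | rename {P : Term α} (hP : Sequential P) (hPc : P.Closed) (R : α → α → Prop) :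
      Sequential (rename P R)

/-- Structurally finite-state processes. -/
inductive SFS {α : Type*} : Term α → Prop where
  | sequential {P : Term α} (hP : Sequential P) (hPc : P.Closed) : SFS P
  | pre (a : α) {P : Term α} (hP : SFS P) : SFS (pre a P)
  | intChoice {P Q : Term α} (hP : SFS P) (hQ : SFS Q) : SFS (intChoice P Q)
  | extChoice {P Q : Term α} (hP : SFS P) (hQ : SFS Q) : SFS (extChoice P Q)
  | par (A : Set α) {P Q : Term α} (hP : SFS P) (hQ : SFS Q) : SFS (par A P Q)
  | seq {P Q : Term α} (hP : SFS P) (hQ : SFS Q) : SFS (seq P Q)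
  | hide {P : Term α} (hP : SFS P) (A : Set α) : SFS (hide P A)
  | rename {P : Term α} (hP : SFS P) (R : α → α → Prop) : SFS (rename P R)

/-- Sequential structurally finite-state processes, i.e. closed sequential terms. -/
def SeqSFS {α : Type*} (P : Term α) : Prop := Sequential P ∧ P.Closed

end Term

/-! ### The analysis of structurally finite-state processes -/

/-- The infinite trace `u` is fair in `F`: each event of `F` occurs infinitely often. -/
def FairIn {α : Type*} (u : ℕ → α) (F : Set α) : Prop := ∀ a ∈ F, {n | u n = a}.Infinite

/-- The infinite trace `u` is co-fair in `C`: each event of `C` occurs finitely often. -/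
def CofairIn {α : Type*} (u : ℕ → α) (C : Set α) : Prop := ∀ b ∈ C, {n | u n = b}.Finite

namespace Term

/-- The fair/co-fair pairs read off from the labelled transition system of `P`: the pairs
`(L, Σ - L)` with `L` non-empty such that some infinite trace of the system is fair in `L` and
co-fair in `Σ - L`. -/
def ltsPairs {α : Type*} (P : Term α) : Set (Set α × Set α) :=
  {p | p.1.Nonempty ∧ p.2 = p.1ᶜ ∧ ∃ u, InfTrace P u ∧ FairIn u p.1 ∧ CofairIn u p.2}

open Classical in
/-- The fair/co-fair pairs `Φ(P)` of a structurally finite-state process `P`. On terms that are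
not structurally finite state the value is irrelevant. -/
noncomputable def fairCofair {α : Type*} : Term α → Set (Set α × Set α)
  | STOP => ltsPairs STOP
  | SKIP => ltsPairs SKIP
  | pre a P =>
      if SeqSFS (pre a P) then ltsPairs (pre a P) else fairCofair P
  | intChoice P₁ P₂ =>
      if SeqSFS (intChoice P₁ P₂) then ltsPairs (intChoice P₁ P₂)
      else fairCofair P₁ ∪ fairCofair P₂
  | extChoice P₁ P₂ =>
      if SeqSFS (extChoice P₁ P₂) then ltsPairs (extChoice P₁ P₂)
      else fairCofair P₁ ∪ fairCofair P₂
  | seq P₁ P₂ =>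
      if SeqSFS (seq P₁ P₂) then ltsPairs (seq P₁ P₂)
      else fairCofair P₁ ∪ fairCofair P₂
  -- a parallel composition is never sequential
  | par A P₁ P₂ =>
      {p | p.1 ∩ p.2 = ∅ ∧ ∃ F₁ C₁ F₂ C₂, (F₁, C₁) ∈ fairCofair P₁ ∧ (F₂, C₂) ∈ fairCofair P₂ ∧
        p.1 = F₁ ∪ F₂ ∧ p.2 = (C₁ ∩ A) ∪ (C₂ ∩ A) ∪ ((C₁ \ A) ∩ (C₂ \ A))} ∪
      {p | p ∈ fairCofair P₁ ∧ p.1 ∩ A = ∅} ∪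
      {p | p ∈ fairCofair P₂ ∧ p.1 ∩ A = ∅}
  | hide P A =>
      if SeqSFS (hide P A) then ltsPairs (hide P A)
      else {p | ∃ F C, (F, C) ∈ fairCofair P ∧ p = (F \ A, C ∪ A)}
  | rename P R =>
      if SeqSFS (rename P R) then ltsPairs (rename P R)
      else {p | ∃ F' C', (F', C') ∈ fairCofair P ∧ F' ⊆ relPreimage R p.1 ∧ p.1 ⊆ relImage R F' ∧
        p.2 = {b | ∀ a, R a b → a ∈ C'}}
  | mu X P => ltsPairs (mu X P)
  | var _ => ∅
  | DIV => ∅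

open Classical in
/-- The livelock flag `δ(P)` of a structurally finite-state process `P`. On terms that are not
structurally finite state the value is irrelevant. -/
noncomputable def livelockFlag {α : Type*} : Term α → Bool
  | STOP => decide (CanDiverge (STOP : Term α))
  | SKIP => decide (CanDiverge (SKIP : Term α))
  | pre a P =>
      if SeqSFS (pre a P) then decide (CanDiverge (pre a P)) else livelockFlag P
  | intChoice P₁ P₂ =>
      if SeqSFS (intChoice P₁ P₂) then decide (CanDiverge (intChoice P₁ P₂))
      else livelockFlag P₁ || livelockFlag P₂
  | extChoice P₁ P₂ =>
      if SeqSFS (extChoice P₁ P₂) then decide (CanDiverge (extChoice P₁ P₂))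
      else livelockFlag P₁ || livelockFlag P₂
  | seq P₁ P₂ =>
      if SeqSFS (seq P₁ P₂) then decide (CanDiverge (seq P₁ P₂))
      else livelockFlag P₁ || livelockFlag P₂
  -- a parallel composition is never sequential
  | par _ P₁ P₂ => livelockFlag P₁ || livelockFlag P₂
  | hide P A =>
      if SeqSFS (hide P A) then decide (CanDiverge (hide P A))
      else if livelockFlag P = false ∧ ∀ p ∈ fairCofair P, (p.1 \ A).Nonempty then false
      else true
  | rename P R =>
      if SeqSFS (rename P R) then decide (CanDiverge (rename P R)) else livelockFlag P
  | mu X P => decide (CanDiverge (mu X P))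
  | var _ => true
  | DIV => true

end Term

end CSP

-- The induction carries more than the flag: if `(U, V) ∈ fairSets P` for an SFS process `P`, then
-- `P` is livelock free and every pair `(F, C)` of `fairCofair P` has `F ∩ V ≠ ∅` (`SFS.sound`). The
-- second half is what hiding and parallel composition need: a hidden set disjoint from `V` cannot
-- swallow all of `F`.
--
-- For closed sequential terms both halves are facts about transitions: no reachable state has an
-- infinite path without events of `V`. Divergence is such a path, and so is a tail of an infinite
-- trace in which `V` occurs only finitely often. This is proved in graded form, with `FairUpTo V n`
-- as an operational substitute for closeness in a metric space of processes. In `fairUpTo_inst` a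
-- variable in which the term is contractive may be instantiated one level lower, so a recursion
-- reaches every level by induction on the level, without a fixed-point theorem.
--
-- Sequential terms allow this because hiding, renaming and the left side of `;` are restricted to
-- closed terms. The first component of a pair can then be ignored, and each membership can be moved
-- to the diagonal pair `(V, V)` (`diag_mem_contr`, `diag_mem_fairSets`). Guard sets enter only
-- through `not_mayTick_of_mem_guards`.

namespace CSP

/-- `γ` is an event of `V`. -/
def Label.Hits {α : Type*} (V : Set α) : Label α → Prop
  | .ev a => a ∈ V
  | .tick => False
  | .tau => False

theorem Label.Hits.mono {α : Type*} {V W : Set α} (h : V ⊆ W) {γ : Label α} (hγ : γ.Hits V) :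
    γ.Hits W := by
  cases γ with
  | ev a => exact h hγ
  | tick => exact hγ
  | tau => exact hγ

namespace Term

variable {α : Type*}

/-! ### Simultaneous instantiation of variables -/

/-- Simultaneous replacement of the free variables of a term (capture is not avoided). -/
def inst (σ : ℕ → Term α) : Term α → Term α
  | STOP => STOP
  | pre a P => pre a (inst σ P)
  | SKIP => SKIP
  | intChoice P₁ P₂ => intChoice (inst σ P₁) (inst σ P₂)
  | extChoice P₁ P₂ => extChoice (inst σ P₁) (inst σ P₂)
  | par A P₁ P₂ => par A (inst σ P₁) (inst σ P₂)
  | seq P₁ P₂ => seq (inst σ P₁) (inst σ P₂)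
  | hide P A => hide (inst σ P) A
  | rename P R => rename (inst σ P) R
  | var X => σ X
  | mu X P => mu X (inst (Function.update σ X (var X)) P)
  | DIV => DIV

theorem inst_congr (P : Term α) :
    ∀ {σ σ' : ℕ → Term α}, (∀ Z ∈ P.fv, σ Z = σ' Z) → inst σ P = inst σ' P := by
  induction P with
  | STOP | SKIP | DIV => intros; rfl
  | pre _ P ih | hide P _ ih | rename P _ ih =>
    intro σ σ' h
    simp only [inst]
    rw [ih h]
  | intChoice P Q ihP ihQ | extChoice P Q ihP ihQ | par _ P Q ihP ihQ | seq P Q ihP ihQ =>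
    intro σ σ' h
    simp only [inst]
    rw [ihP fun Z hZ => h Z (Or.inl hZ), ihQ fun Z hZ => h Z (Or.inr hZ)]
  | var X => intro σ σ' h; exact h X rfl
  | mu X P ih =>
    intro σ σ' h
    simp only [inst]
    rw [ih (σ' := Function.update σ' X (var X))]
    intro Z hZ
    by_cases hX : Z = X
    · subst hX; simp
    · simpa [hX] using h Z ⟨hZ, hX⟩

theorem inst_var (P : Term α) : inst var P = P := by
  induction P <;> simp_all [inst]

theorem inst_of_closed {P : Term α} (hP : P.Closed) (σ : ℕ → Term α) : inst σ P = P := by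
  rw [inst_congr P (σ' := var), inst_var]
  intro Z hZ
  rw [Closed] at hP
  simp [hP] at hZ

theorem exists_of_mem_fv_inst (P : Term α) :
    ∀ {σ : ℕ → Term α} {Z : ℕ}, Z ∈ (inst σ P).fv → ∃ Y ∈ P.fv, Z ∈ (σ Y).fv := by
  induction P with
  | STOP | SKIP | DIV => intro σ Z h; exact absurd h (Set.notMem_empty _)
  | pre _ P ih | hide P _ ih | rename P _ ih => intro σ Z h; exact ih h
  | intChoice P Q ihP ihQ | extChoice P Q ihP ihQ | par _ P Q ihP ihQ | seq P Q ihP ihQ =>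
    intro σ Z h
    rcases h with h | h
    · obtain ⟨Y, hY, h⟩ := ihP h
      exact ⟨Y, Or.inl hY, h⟩
    · obtain ⟨Y, hY, h⟩ := ihQ h
      exact ⟨Y, Or.inr hY, h⟩
  | var X => intro σ Z h; exact ⟨X, rfl, h⟩
  | mu X P ih =>
    rintro σ Z ⟨h, hZ⟩
    obtain ⟨Y, hY, h⟩ := ih h
    by_cases hX : Y = X
    · subst hX
      simp only [Function.update_self] at h
      exact absurd h hZ
    · simp only [Function.update_of_ne hX] at h
      exact ⟨Y, ⟨hY, hX⟩, h⟩

theorem closed_inst_mu {σ : ℕ → Term α} (hσ : ∀ Z, (σ Z).Closed) (X : ℕ) (P : Term α) :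
    (inst σ (mu X P)).Closed := by
  refine Set.eq_empty_of_forall_notMem fun Z hZ => ?_
  obtain ⟨Y, -, h⟩ := exists_of_mem_fv_inst (mu X P) hZ
  rw [hσ Y] at h
  exact h

theorem subst_eq_self (X : ℕ) (M : Term α) (P : Term α) : X ∉ P.fv → subst X M P = P := by
  induction P with
  | var Y => intro h; exact if_neg fun hY => h hY.symm
  | mu Y P ih =>
    intro h
    rw [subst]
    split_ifs with hY
    · rfl
    · rw [ih fun hX => h ⟨hX, Ne.symm hY⟩]
  | _ => simp_all [subst, fv]

/-- Substituting for a bound variable after instantiating under the binder amounts to updating the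
instantiation. The values at other variables must not mention `X`, since `subst` would act on them
too. -/
theorem subst_inst (X : ℕ) (M : Term α) (P : Term α) :
    ∀ {σ : ℕ → Term α}, (∀ Z, Z ≠ X → X ∉ (σ Z).fv) →
      subst X M (inst (Function.update σ X (var X)) P) = inst (Function.update σ X M) P := by
  induction P with
  | STOP | SKIP | DIV => intros; rfl
  | pre _ P ih | hide P _ ih | rename P _ ih =>
    intro σ h
    simp only [inst, subst]
    rw [ih h]
  | intChoice P Q ihP ihQ | extChoice P Q ihP ihQ | par _ P Q ihP ihQ | seq P Q ihP ihQ =>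
    intro σ h
    simp only [inst, subst]
    rw [ihP h, ihQ h]
  | var Y =>
    intro σ h
    by_cases hY : Y = X
    · subst hY; simp [inst, subst]
    · simpa [inst, hY] using subst_eq_self X M _ (h Y hY)
  | mu Y P ih =>
    intro σ h
    by_cases hY : Y = X
    · subst hY; simp [inst, subst]
    · simp only [inst, subst, if_neg hY]
      rw [Function.update_comm (Ne.symm hY), ih, Function.update_comm (Ne.symm hY)]
      intro Z hZ
      by_cases hZY : Z = Y
      · subst hZY; simpa [fv] using Ne.symm hZ
      · simpa [hZY] using h Z hZ

/-- Unfolding a recursion only changes the instantiation of its body. Structural induction on open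
terms, uniform in `σ`, can therefore follow transitions although unfolding enlarges terms. -/
theorem inst_mu_step {σ : ℕ → Term α} (hσ : ∀ Z, (σ Z).Closed) {X : ℕ} {P S : Term α}
    {γ : Label α} (h : Step (inst σ (mu X P)) γ S) :
    γ = .tau ∧ S = inst (Function.update σ X (inst σ (mu X P))) P := by
  cases h with
  | mu =>
    refine ⟨rfl, ?_⟩
    refine subst_inst X _ P fun Z _ hX => ?_
    rw [hσ Z] at hX
    exact hX

theorem closed_update {σ : ℕ → Term α} (hσ : ∀ Z, (σ Z).Closed) {X : ℕ} {M : Term α}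
    (hM : M.Closed) (Z : ℕ) : (Function.update σ X M Z).Closed := by
  by_cases hZ : Z = X
  · subst hZ; simpa using hM
  · simpa [hZ] using hσ Z

/-! ### Termination without an event of a given set -/

/-- `P` can terminate successfully without performing an event of `V`. -/
inductive MayTick (V : Set α) : Term α → Prop where
  | tick {P P' : Term α} (h : Step P .tick P') : MayTick V P
  | step {γ : Label α} {P P' : Term α} (hγ : ¬ γ.Hits V) (h : Step P γ P') (hP : MayTick V P') :
      MayTick V P

theorem not_mayTick_STOP (V : Set α) : ¬ MayTick V (STOP : Term α) := by
  intro h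
  cases h with
  | tick h => cases h
  | step _ h _ => cases h

theorem MayTick.of_pre {V : Set α} {a : α} {P : Term α} (h : MayTick V (pre a P)) :
    a ∉ V ∧ MayTick V P := by
  cases h with
  | tick h => cases h
  | step hγ h hP => cases h; exact ⟨hγ, hP⟩

theorem MayTick.of_intChoice {V : Set α} {P Q : Term α} (h : MayTick V (intChoice P Q)) :
    MayTick V P ∨ MayTick V Q := by
  cases h with
  | tick h => cases h
  | step hγ h hP =>
    cases h
    · exact Or.inl hP
    · exact Or.inr hP

theorem MayTick.of_extChoice {V : Set α} {S : Term α} (h : MayTick V S) :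
    ∀ {P Q : Term α}, S = extChoice P Q → MayTick V P ∨ MayTick V Q := by
  induction h with
  | tick h =>
    rintro P Q rfl
    cases h with
    | extChoiceL _ h => exact Or.inl (.tick h)
    | extChoiceR _ h => exact Or.inr (.tick h)
  | step hγ h hP ih =>
    rintro P Q rfl
    cases h with
    | extChoiceTauL h => exact (ih rfl).imp_left (.step hγ h)
    | extChoiceTauR h => exact (ih rfl).imp_right (.step hγ h)
    | extChoiceL _ h => exact Or.inl (.step hγ h hP)
    | extChoiceR _ h => exact Or.inr (.step hγ h hP)

theorem MayTick.of_seq {V : Set α} {S : Term α} (h : MayTick V S) :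
    ∀ {P Q : Term α}, S = seq P Q → MayTick V P ∧ MayTick V Q := by
  induction h with
  | tick h =>
    rintro P Q rfl
    cases h with
    | seqL hγ _ => exact absurd rfl hγ
  | step hγ h hP ih =>
    rintro P Q rfl
    cases h with
    | seqTick h => exact ⟨.tick h, hP⟩
    | seqL _ h => exact (ih rfl).imp_left (.step hγ h)

theorem MayTick.of_hide {V V' A : Set α} (hA : V' ∩ A = ∅) (hV : V' ⊆ V) {S : Term α}
    (h : MayTick V S) : ∀ {P : Term α}, S = hide P A → MayTick V' P := by
  induction h with
  | tick h =>
    rintro P rfl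
    cases h with
    | hideOut _ h => exact .tick h
  | step hγ h hP ih =>
    rintro P rfl
    cases h with
    | hideIn ha h => exact .step (fun hV' => hA.subset ⟨hV', ha⟩) h (ih rfl)
    | hideOut _ h => exact .step (fun hV' => hγ (hV'.mono hV)) h (ih rfl)

theorem LiftRel.hits {R : α → α → Prop} {γ γ' : Label α} (h : LiftRel R γ γ') {V : Set α}
    (hγ : γ.Hits V) : γ'.Hits (relImage R V) := by
  cases h with
  | ev h => exact ⟨_, hγ, h⟩
  | tick => exact hγ

theorem MayTick.of_rename {V V' : Set α} {R : α → α → Prop} (hV : relImage R V' ⊆ V)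
    {S : Term α} (h : MayTick V S) : ∀ {P : Term α}, S = rename P R → MayTick V' P := by
  induction h with
  | tick h =>
    rintro P rfl
    cases h with
    | rename hR h => cases hR; exact .tick h
  | step hγ h hP ih =>
    rintro P rfl
    cases h with
    | renameTau h => exact .step id h (ih rfl)
    | rename hR h => exact .step (fun hV' => hγ ((LiftRel.hits hR hV').mono hV)) h (ih rfl)

/-- Variables have no guard sets, so nothing but closedness is asked of `σ`. This makes one
unfolding of a recursion enough: the induction hypothesis for the body already covers the updated
instantiation. -/
theorem not_mayTick_of_mem_guards {P : Term α} (hP : Sequential P) :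
    ∀ {V : Set α} {σ : ℕ → Term α}, (∀ Z, (σ Z).Closed) → V ∈ guards P →
      ¬ MayTick V (inst σ P) := by
  induction hP with
  | STOP => intro V σ _ _; exact not_mayTick_STOP V
  | SKIP | var _ => intro V σ _ h; simp [guards] at h
  | pre a _ ih =>
    intro V σ hσ h ht
    rw [guards] at h
    rcases h with h | h
    · exact ih hσ h ht.of_pre.2
    · exact ht.of_pre.1 h
  | intChoice _ _ ihP ihQ =>
    intro V σ hσ h ht
    rw [guards] at h
    exact ht.of_intChoice.elim (ihP hσ h.1) (ihQ hσ h.2)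
  | extChoice _ _ ihP ihQ =>
    intro V σ hσ h ht
    rw [guards] at h
    exact (ht.of_extChoice rfl).elim (ihP hσ h.1) (ihQ hσ h.2)
  | @mu X P _ ih =>
    intro V σ hσ h ht
    rw [guards] at h
    have hM := closed_update hσ (X := X) (closed_inst_mu hσ X P)
    cases ht with
    | tick hs => exact absurd (inst_mu_step hσ hs).1 (by simp)
    | step _ hs ht =>
      rw [(inst_mu_step hσ hs).2] at ht
      exact ih hM h ht
  | seq _ _ _ ihP ihQ =>
    intro V σ hσ h ht
    rw [guards] at h
    obtain ⟨h₁, h₂⟩ := ht.of_seq rfl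
    split_ifs at h
    · exact h.elim (fun h => ihP hσ h h₁) (fun h => ihQ hσ h h₂)
    · exact ihP hσ h h₁
  | hide _ _ A ih =>
    intro V σ hσ h ht
    rw [guards] at h
    split_ifs at h
    · obtain ⟨V', h, hA, hV⟩ := h
      exact ih hσ h (ht.of_hide hA hV rfl)
    · exact h
  | rename _ _ R ih =>
    intro V σ hσ h ht
    rw [guards] at h
    obtain ⟨V', h, hV⟩ := h
    exact ih hσ h (ht.of_rename hV rfl)

/-! ### Fairness up to a number of events -/

/-- Along every path of `P`, at least `n` events of `V` occur before the path can have
an infinite remainder without such events. -/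
inductive FairUpTo (V : Set α) : ℕ → Term α → Prop where
  | zero (P : Term α) : FairUpTo V 0 P
  | succ {n : ℕ} {P : Term α} (hit : ∀ γ P', γ.Hits V → Step P γ P' → FairUpTo V n P')
      (miss : ∀ γ P', ¬ γ.Hits V → Step P γ P' → FairUpTo V (n + 1) P') : FairUpTo V (n + 1) P

namespace FairUpTo

variable {V : Set α} {n : ℕ} {P Q : Term α}

theorem of_step (h : FairUpTo V (n + 1) P) {γ : Label α} {P' : Term α} (hs : Step P γ P') :
    (γ.Hits V → FairUpTo V n P') ∧ (¬ γ.Hits V → FairUpTo V (n + 1) P') := by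
  cases h with
  | succ hit miss => exact ⟨fun hγ => hit γ P' hγ hs, fun hγ => miss γ P' hγ hs⟩

/-- The truncated `m - 1` leaves the index a variable, so that induction on the derivation applies;
`of_succ` is the usable form. -/
theorem pred {m : ℕ} (h : FairUpTo V m P) : FairUpTo V (m - 1) P := by
  induction h with
  | zero P => exact .zero P
  | @succ n P hit miss ihh ihm =>
    cases n with
    | zero => exact .zero P
    | succ n => exact .succ (fun γ P' hγ hs => ihh γ P' hγ hs) fun γ P' hγ hs => ihm γ P' hγ hs

theorem of_succ (h : FairUpTo V (n + 1) P) : FairUpTo V n P := h.pred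

theorem of_le {m : ℕ} (hnm : n ≤ m) (h : FairUpTo V m P) : FairUpTo V n P := by
  induction hnm with
  | refl => exact h
  | step _ ih => exact ih h.of_succ

theorem mono {W : Set α} (hVW : V ⊆ W) (h : FairUpTo V n P) : FairUpTo W n P := by
  induction h with
  | zero P => exact .zero P
  | succ hit miss ihh ihm =>
    refine .succ (fun γ P' hγ hs => ?_) fun γ P' hγ hs => ?_
    · by_cases hV : γ.Hits V
      · exact ihh γ P' hV hs
      -- An event of `W` outside `V` lowers the count for `W` but not for `V`, so one level is given
      -- up.
      · exact (ihm γ P' hV hs).of_succ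
    · exact ihm γ P' (fun hV => hγ (hV.mono hVW)) hs

theorem STOP : FairUpTo V n (Term.STOP : Term α) := by
  cases n with
  | zero => exact .zero _
  | succ n => exact .succ (fun γ P' _ hs => by cases hs) fun γ P' _ hs => by cases hs

theorem SKIP : FairUpTo V n (Term.SKIP : Term α) := by
  cases n with
  | zero => exact .zero _
  | succ n =>
    exact .succ (fun γ P' _ hs => by cases hs; exact STOP)
      fun γ P' _ hs => by cases hs; exact STOP

theorem pre {a : α} (hit : a ∈ V → FairUpTo V n P) (miss : a ∉ V → FairUpTo V (n + 1) P) :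
    FairUpTo V (n + 1) (Term.pre a P) :=
  .succ (fun γ P' hγ hs => by cases hs; exact hit hγ)
    fun γ P' hγ hs => by cases hs; exact miss hγ

theorem intChoice (hP : FairUpTo V n P) (hQ : FairUpTo V n Q) :
    FairUpTo V n (Term.intChoice P Q) := by
  cases n with
  | zero => exact .zero _
  | succ n =>
    exact .succ (fun γ P' hγ hs => by cases hs <;> exact hγ.elim)
      fun γ P' _ hs => by cases hs <;> assumption

/-- Silent steps of the two components interleave without resolving the choice, hence an induction
on the second derivation nested inside that on the first. -/
theorem extChoice (hP : FairUpTo V n P) (hQ : FairUpTo V n Q) :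
    FairUpTo V n (Term.extChoice P Q) := by
  induction hP generalizing Q with
  | zero P => exact .zero _
  | @succ n P hit miss ihh ihm =>
    have hP : FairUpTo V (n + 1) P := .succ hit miss
    generalize hm : n + 1 = m at hQ
    induction hQ with
    | zero Q => simp at hm
    | @succ m Q hit' miss' _ ihm' =>
      obtain rfl : n = m := by simpa using hm
      refine .succ (fun γ S hγ hs => ?_) fun γ S hγ hs => ?_
      · cases hs with
        | extChoiceTauL h => exact hγ.elim
        | extChoiceTauR h => exact hγ.elim
        | extChoiceL _ h => exact hit _ _ hγ h
        | extChoiceR _ h => exact hit' _ _ hγ h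
      · cases hs with
        | extChoiceTauL h => exact ihm _ _ hγ h (.succ hit' miss')
        | extChoiceTauR h => exact ihm' _ _ hγ h rfl
        | extChoiceL _ h => exact miss _ _ hγ h
        | extChoiceR _ h => exact miss' _ _ hγ h

theorem seq (hP : FairUpTo V n P) (hQ : FairUpTo V n Q) : FairUpTo V n (Term.seq P Q) := by
  induction hP with
  | zero P => exact .zero _
  | succ hit miss ihh ihm =>
    refine .succ (fun γ S hγ hs => ?_) fun γ S hγ hs => ?_
    · cases hs with
      | seqTick h => exact hγ.elim
      | seqL _ h => exact ihh _ _ hγ h hQ.of_succ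
    · cases hs with
      | seqTick h => exact hQ
      | seqL _ h => exact ihm _ _ hγ h hQ

/-- Control reaches `Q` only after an event of `V` has been counted, so `Q` may be one level lower.
This is the operational content of the guard clause in `contr` for `;`. -/
theorem seq_of_not_mayTick {m : ℕ} (hP : FairUpTo V m P) :
    m = n + 1 → ¬ MayTick V P → FairUpTo V n Q → FairUpTo V (n + 1) (Term.seq P Q) := by
  induction hP with
  | zero P => simp
  | @succ m P hit miss ihh ihm =>
    intro hm ht hQ
    obtain rfl : m = n := by simpa using hm
    refine .succ (fun γ S hγ hs => ?_) fun γ S hγ hs => ?_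
    · cases hs with
      | seqTick h => exact hγ.elim
      | seqL _ h => exact (hit _ _ hγ h).seq hQ
    · cases hs with
      | seqTick h => exact absurd (.tick h) ht
      | seqL _ h => exact ihm _ _ hγ h rfl (fun ht' => ht (.step hγ h ht')) hQ

theorem hide {A : Set α} (hA : V ∩ A = ∅) (hP : FairUpTo V n P) :
    FairUpTo V n (Term.hide P A) := by
  induction hP with
  | zero P => exact .zero _
  | succ hit miss ihh ihm =>
    refine .succ (fun γ S hγ hs => ?_) fun γ S hγ hs => ?_
    · cases hs with
      | hideIn ha h => exact hγ.elim
      | hideOut _ h => exact ihh _ _ hγ h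
    · cases hs with
      | hideIn ha h => exact ihm _ _ (fun hV => hA.subset ⟨hV, ha⟩) h
      | hideOut _ h => exact ihm _ _ hγ h

theorem rename {R : α → α → Prop} (hP : FairUpTo V n P) :
    FairUpTo (relImage R V) n (Term.rename P R) := by
  induction hP with
  | zero P => exact .zero _
  | succ hit miss ihh ihm =>
    refine .succ (fun γ S hγ hs => ?_) fun γ S hγ hs => ?_
    · cases hs with
      | renameTau h => exact hγ.elim
      | @rename _ δ _ _ _ hR h =>
        by_cases hδ : δ.Hits V
        · exact ihh _ _ hδ h
        -- The new label may lie in `relImage R V` although the original event is outside `V`,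
        -- because it can have several preimages.
        · exact (ihm _ _ hδ h).of_succ
    · cases hs with
      | renameTau h => exact ihm _ _ id h
      | rename hR h => exact ihm _ _ (fun hV => hγ (LiftRel.hits hR hV)) h

end FairUpTo

/-! ### The general analysis on sequential terms -/

/-- Only hiding and renaming could break the inclusion demanded at a variable, and in a sequential
term no free variable lies below them. Nonexpansiveness is thus automatic on the diagonal. -/
theorem diag_mem_nonexp (X : ℕ) (V : Set α) {P : Term α} (hP : Sequential P) :
    (V, V) ∈ nonexp X P := by
  induction hP generalizing X with
  | STOP | SKIP => simp [nonexp]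
  | var Y => simp [nonexp]
  | pre a _ ih => simp [nonexp, ih X]
  | intChoice _ _ ihP ihQ | extChoice _ _ ihP ihQ | seq _ _ _ ihP ihQ =>
    simp [nonexp, ihP X, ihQ X]
  | mu Y _ ih =>
    rw [nonexp]
    split_ifs
    · exact ⟨V, V, ih X, ih Y, subset_rfl, subset_rfl⟩
    · trivial
  | hide _ hc A | rename _ hc R =>
    rw [Closed] at hc
    simp [nonexp, fv, hc]

theorem guards_mono {P : Term α} (hP : Sequential P) {V W : Set α} (hVW : V ⊆ W)
    (h : V ∈ guards P) : W ∈ guards P := by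
  induction hP with
  | STOP | SKIP | var _ => simp_all [guards]
  | pre a _ ih =>
    rw [guards] at h ⊢
    exact h.imp ih fun h => hVW h
  | intChoice _ _ ihP ihQ | extChoice _ _ ihP ihQ =>
    rw [guards] at h ⊢
    exact h.imp ihP ihQ
  | seq _ _ _ ihP ihQ =>
    rw [guards] at h ⊢
    split_ifs at h ⊢
    · exact h.imp ihP ihQ
    · exact ihP h
  | mu Y _ ih =>
    rw [guards] at h ⊢
    exact ih h
  | hide _ _ A | rename _ _ R =>
    rw [guards] at h ⊢
    grind

theorem diag_mem_contr {X : ℕ} {P : Term α} (hP : Sequential P) {U V W : Set α} (hVW : V ⊆ W)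
    (h : (U, V) ∈ contr X P) : (W, W) ∈ contr X P := by
  induction hP generalizing U V with
  | STOP | SKIP => simp [contr]
  | var Y =>
    rw [contr] at h ⊢
    split_ifs at h ⊢
    · exact h
    · trivial
  | pre a hP ih =>
    rw [contr] at h ⊢
    split_ifs at h ⊢
    · exact h.imp (ih hVW) fun h => ⟨diag_mem_nonexp X W hP, hVW h.2⟩
    · trivial
  | intChoice _ _ ihP ihQ | extChoice _ _ ihP ihQ =>
    rw [contr] at h ⊢
    split_ifs at h ⊢
    · exact h.imp (ihP hVW) (ihQ hVW)
    · trivial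
  | seq hP _ hQ ihP ihQ =>
    rw [contr] at h ⊢
    split_ifs at h ⊢
    · exact h.imp (ihP hVW) fun h => h.imp (ihQ hVW) fun h =>
        ⟨diag_mem_nonexp X W hQ, guards_mono hP hVW h.2⟩
    · trivial
  | mu Y hP ih =>
    rw [contr] at h ⊢
    split_ifs at h ⊢
    · obtain ⟨U', V', h, -, -, hV⟩ := h
      exact ⟨W, W, ih (hV.trans hVW) h, diag_mem_nonexp Y W hP, subset_rfl, subset_rfl⟩
    · trivial
  | hide _ hc A | rename _ hc R =>
    rw [Closed] at hc
    simp [contr, fv, hc]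

/-- The first component is constrained only by free variables and by open recursions. Below hiding
and renaming this frees it to be moved to the diagonal. -/
theorem mem_fairSets_of_closed {P : Term α} (hP : Sequential P) (hc : P.Closed) {U U' V : Set α}
    (h : (U, V) ∈ fairSets P) : (U', V) ∈ fairSets P := by
  induction hP generalizing V with
  | STOP | SKIP => simp [fairSets]
  | var Y => simp [Closed, fv] at hc
  | pre a _ ih =>
    rw [fairSets] at h ⊢
    exact ih hc h
  | intChoice _ _ ihP ihQ | extChoice _ _ ihP ihQ | seq _ _ _ ihP ihQ =>
    rw [fairSets] at h ⊢
    rw [Closed, fv, Set.union_empty_iff] at hc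
    exact ⟨ihP hc.1 h.1, ihQ hc.2 h.2⟩
  | mu Y _ ih =>
    rw [fairSets, if_pos hc] at h ⊢
    exact h
  | hide _ hc A ih | rename _ hc R ih =>
    rw [fairSets] at h ⊢
    obtain ⟨V', h, h'⟩ := h
    exact ⟨V', ih hc h, h'⟩

theorem diag_mem_fairSets {P : Term α} (hP : Sequential P) {U V W : Set α} (hVW : V ⊆ W)
    (h : (U, V) ∈ fairSets P) : (W, W) ∈ fairSets P := by
  induction hP generalizing U V with
  | STOP | SKIP => simp [fairSets]
  | var Y => simp [fairSets]
  | pre a _ ih =>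
    rw [fairSets] at h ⊢
    exact ih hVW h
  | intChoice _ _ ihP ihQ | extChoice _ _ ihP ihQ | seq _ _ _ ihP ihQ =>
    rw [fairSets] at h ⊢
    exact h.imp (ihP hVW) (ihQ hVW)
  | mu Y hP ih =>
    have key : ∀ {S : Set α}, (S, S) ∈ contr Y _ ∩ fairSets _ → S ⊆ V →
        (W, W) ∈ contr Y _ ∩ fairSets _ := fun hS hSV =>
      ⟨diag_mem_contr hP (hSV.trans hVW) hS.1, ih (hSV.trans hVW) hS.2⟩
    rw [fairSets] at h ⊢
    split_ifs at h ⊢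
    · obtain ⟨S, hS, hSV⟩ := h
      exact ⟨W, key hS hSV, subset_rfl⟩
    · obtain ⟨S, hS, -, hSV⟩ := h
      exact ⟨W, key hS hSV, subset_rfl, subset_rfl⟩
  | hide hP hc A ih =>
    rw [fairSets] at h ⊢
    obtain ⟨V', h, hA, hV⟩ := h
    exact ⟨V', mem_fairSets_of_closed hP hc h, hA, hV.trans hVW⟩
  | rename hP hc R ih =>
    rw [fairSets] at h ⊢
    obtain ⟨V', h, hV⟩ := h
    exact ⟨V', mem_fairSets_of_closed hP hc h, hV.trans hVW⟩

/-- Soundness of the general analysis on sequential terms, in graded form: a variable in which the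
term is contractive needs one event of `V` less. -/
theorem fairUpTo_inst {P : Term α} (hP : Sequential P) :
    ∀ {V : Set α} {n : ℕ} {σ : ℕ → Term α}, (∀ Z, (σ Z).Closed) → (V, V) ∈ fairSets P →
      (∀ Z ∈ P.fv, FairUpTo V (n + 1) (σ Z) ∨ ((V, V) ∈ contr Z P ∧ FairUpTo V n (σ Z))) →
      FairUpTo V (n + 1) (inst σ P) := by
  -- Nonexpansiveness at an arbitrary level, including zero; it is used once an event of `V` has
  -- paid for one level.
  have weak : ∀ {P : Term α}, (∀ {V : Set α} {n : ℕ} {σ : ℕ → Term α}, (∀ Z, (σ Z).Closed) →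
      (V, V) ∈ fairSets P →
      (∀ Z ∈ P.fv, FairUpTo V (n + 1) (σ Z) ∨ ((V, V) ∈ contr Z P ∧ FairUpTo V n (σ Z))) →
      FairUpTo V (n + 1) (inst σ P)) →
      ∀ {V : Set α} {n : ℕ} {σ : ℕ → Term α}, (∀ Z, (σ Z).Closed) → (V, V) ∈ fairSets P →
      (∀ Z ∈ P.fv, FairUpTo V n (σ Z)) → FairUpTo V n (inst σ P) := by
    intro P h V n σ hσ hF hv
    cases n with
    | zero => exact .zero _
    | succ n => exact h hσ hF fun Z hZ => Or.inl (hv Z hZ)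
  have closed : ∀ {P : Term α}, P.Closed → ∀ (Z : ℕ) (p : Prop), Z ∈ P.fv → p := by
    intro P hc Z p hZ
    rw [hc] at hZ
    exact hZ.elim
  induction hP with
  | STOP => intros; exact FairUpTo.STOP
  | SKIP => intros; exact FairUpTo.SKIP
  | var X =>
    intro V n σ hσ hF hv
    rcases hv X rfl with h | ⟨h, -⟩
    · exact h
    · simp [contr, fv] at h
  | @pre a P hP ih =>
    intro V n σ hσ hF hv
    rw [fairSets] at hF
    refine .pre (fun ha => weak ih hσ hF fun Z hZ => ?_) fun ha => ih hσ hF fun Z hZ => ?_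
    · exact (hv Z hZ).elim FairUpTo.of_succ fun h => h.2
    · refine (hv Z hZ).imp_right fun h => ⟨?_, h.2⟩
      have h := h.1
      -- As `a ∉ V`, the prefix guards nothing, and contractivity must come from the body.
      rw [contr, if_pos (show Z ∈ (Term.pre a P).fv from hZ)] at h
      exact h.elim id fun h => absurd h.2 ha
  | @intChoice P Q hP hQ ihP ihQ =>
    intro V n σ hσ hF hv
    rw [fairSets] at hF
    refine FairUpTo.intChoice (ihP hσ hF.1 fun Z hZ => ?_) (ihQ hσ hF.2 fun Z hZ => ?_)
    · refine (hv Z (Or.inl hZ)).imp_right fun h => ⟨?_, h.2⟩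
      have h := h.1
      rw [contr, if_pos (show Z ∈ (Term.intChoice P Q).fv from Or.inl hZ)] at h
      exact h.1
    · refine (hv Z (Or.inr hZ)).imp_right fun h => ⟨?_, h.2⟩
      have h := h.1
      rw [contr, if_pos (show Z ∈ (Term.intChoice P Q).fv from Or.inr hZ)] at h
      exact h.2
  | @extChoice P Q hP hQ ihP ihQ =>
    intro V n σ hσ hF hv
    rw [fairSets] at hF
    refine FairUpTo.extChoice (ihP hσ hF.1 fun Z hZ => ?_) (ihQ hσ hF.2 fun Z hZ => ?_)
    · refine (hv Z (Or.inl hZ)).imp_right fun h => ⟨?_, h.2⟩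
      have h := h.1
      rw [contr, if_pos (show Z ∈ (Term.extChoice P Q).fv from Or.inl hZ)] at h
      exact h.1
    · refine (hv Z (Or.inr hZ)).imp_right fun h => ⟨?_, h.2⟩
      have h := h.1
      rw [contr, if_pos (show Z ∈ (Term.extChoice P Q).fv from Or.inr hZ)] at h
      exact h.2
  | @seq P Q hP hc hQ ihP ihQ =>
    intro V n σ hσ hF hv
    rw [fairSets] at hF
    have hP' : FairUpTo V (n + 1) (inst σ P) := ihP hσ hF.1 fun Z hZ => closed hc Z _ hZ
    by_cases hG : V ∈ guards P
    · refine hP'.seq_of_not_mayTick rfl (not_mayTick_of_mem_guards hP hσ hG)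
        (weak ihQ hσ hF.2 fun Z hZ => ?_)
      exact (hv Z (Or.inr hZ)).elim FairUpTo.of_succ fun h => h.2
    · refine hP'.seq (ihQ hσ hF.2 fun Z hZ => ?_)
      refine (hv Z (Or.inr hZ)).imp_right fun h => ⟨?_, h.2⟩
      have h := h.1
      rw [contr, if_pos (show Z ∈ (Term.seq P Q).fv from Or.inr hZ)] at h
      exact h.2.elim id fun h => absurd h.2 hG
  | @mu X P hP ih =>
    intro V n σ hσ hF hv
    have hW : (V, V) ∈ contr X P ∩ fairSets P := by
      have key : ∀ {S : Set α}, (S, S) ∈ contr X P ∩ fairSets P → S ⊆ V →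
          (V, V) ∈ contr X P ∩ fairSets P := fun hS hSV =>
        ⟨diag_mem_contr hP hSV hS.1, diag_mem_fairSets hP hSV hS.2⟩
      rw [fairSets] at hF
      split_ifs at hF
      · obtain ⟨S, hS, hSV⟩ := hF
        exact key hS hSV
      · obtain ⟨S, hS, -, hSV⟩ := hF
        exact key hS hSV
    -- The recursive process gains one level per pass: contractivity in `X` lets level `k` at `X`
    -- yield level `k + 1` for the unfolded body. The bound on `k` is what the other variables can
    -- supply.
    have hM : ∀ k ≤ n + 1, FairUpTo V k (inst σ (.mu X P)) := by
      intro k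
      induction k with
      | zero => intro _; exact .zero _
      | succ k ihk =>
        intro hk
        have hk' : k ≤ n := by omega
        have body : FairUpTo V (k + 1)
            (inst (Function.update σ X (inst σ (.mu X P))) P) := by
          refine ih (closed_update hσ (closed_inst_mu hσ X P)) hW.2 fun Z hZ => ?_
          by_cases hX : Z = X
          · subst hX
            rw [Function.update_self]
            exact Or.inr ⟨hW.1, ihk (by omega)⟩
          · rw [Function.update_of_ne hX]
            have hZ' : Z ∈ (Term.mu X P).fv := ⟨hZ, hX⟩
            refine (hv Z hZ').imp (FairUpTo.of_le hk) fun h => ⟨?_, h.2.of_le hk'⟩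
            have h := h.1
            rw [contr, if_pos hZ'] at h
            obtain ⟨U', V', h, -, -, hV⟩ := h
            exact diag_mem_contr hP hV h
        refine .succ (fun γ S hγ hs => ?_) fun γ S _ hs => ?_
        · rw [(inst_mu_step hσ hs).1] at hγ
          exact hγ.elim
        · rw [(inst_mu_step hσ hs).2]
          exact body
    exact hM _ le_rfl
  | @hide P hP hc A ih =>
    intro V n σ hσ hF hv
    rw [fairSets] at hF
    obtain ⟨V', h, hA, hV⟩ := hF
    exact ((ih hσ (diag_mem_fairSets hP subset_rfl h) fun Z hZ => closed hc Z _ hZ).hide hA).mono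
      hV
  | @rename P hP hc R ih =>
    intro V n σ hσ hF hv
    rw [fairSets] at hF
    obtain ⟨V', h, hV⟩ := hF
    exact (ih hσ (diag_mem_fairSets hP subset_rfl h) fun Z hZ => closed hc Z _ hZ).rename.mono hV

theorem fairUpTo_of_mem_fairSets {P : Term α} (hP : SeqSFS P) {U V : Set α}
    (h : (U, V) ∈ fairSets P) (n : ℕ) : FairUpTo V n P := by
  have := fairUpTo_inst hP.1 (n := n) (σ := fun _ => STOP) (fun _ => rfl)
    (diag_mem_fairSets hP.1 subset_rfl h) fun Z _ => Or.inl FairUpTo.STOP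
  rw [inst_of_closed hP.2] at this
  exact this.of_succ

/-! ### Livelock freedom and fairness of infinite traces -/

/-- Any positive level makes the steps that miss `V` well-founded; `τ` and `✓` count among these
steps. -/
theorem FairUpTo.acc {V : Set α} {n : ℕ} {P : Term α} (h : FairUpTo V n P) :
    n ≠ 0 → Acc (fun S' S => ∃ γ : Label α, ¬ γ.Hits V ∧ Step S γ S') P := by
  induction h with
  | zero P => simp
  | succ hit miss _ ihm =>
    rintro -
    exact ⟨_, fun S ⟨γ, hγ, hs⟩ => ihm γ S hγ hs (by simp)⟩

theorem not_acc_of_seq {β : Type*} {r : β → β → Prop} (s : ℕ → β)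
    (hs : ∀ n, r (s (n + 1)) (s n)) : ¬ Acc r (s 0) := by
  intro h
  generalize hx : s 0 = x at h
  induction h generalizing s with
  | intro x _ ih =>
    exact ih (s 1) (hx ▸ hs 0) (fun n => s (n + 1)) (fun n => hs (n + 1)) rfl

theorem fairUpTo_of_reachable {V : Set α} {P Q : Term α} (hP : ∀ n, FairUpTo V n P)
    (h : Reachable P Q) (n : ℕ) : FairUpTo V n Q := by
  induction h generalizing n with
  | refl => exact hP n
  | tail _ hs ih =>
    obtain ⟨γ, hs⟩ := hs
    by_cases hγ : γ.Hits V
    · exact ((ih (n + 1)).of_step hs).1 hγ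
    · exact (((ih (n + 1)).of_step hs).2 hγ).of_succ

theorem not_canDiverge_of_fairUpTo {V : Set α} {P : Term α} (hP : ∀ n, FairUpTo V n P) :
    ¬ CanDiverge P := by
  rintro ⟨Q, hQ, s, rfl, hs⟩
  exact not_acc_of_seq s (fun n => ⟨.tau, id, hs n⟩)
    ((fairUpTo_of_reachable hP hQ 1).acc one_ne_zero)

theorem WeakStep.reachable {P Q : Term α} {a : α} (h : WeakStep P a Q) : Reachable P Q := by
  obtain ⟨S, hS, hs⟩ := h
  exact (Relation.ReflTransGen.mono (fun _ _ h => ⟨_, h⟩) _ _ hS).tail ⟨_, hs⟩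

theorem WeakStep.transGen {V : Set α} {P Q : Term α} {a : α} (ha : a ∉ V) (h : WeakStep P a Q) :
    Relation.TransGen (fun S' S => ∃ γ : Label α, ¬ γ.Hits V ∧ Step S γ S') Q P := by
  obtain ⟨S, hS, hs⟩ := h
  rw [← Relation.transGen_swap]
  exact Relation.TransGen.tail' (Relation.ReflTransGen.mono (fun _ _ h => ⟨.tau, id, h⟩) _ _ hS) ⟨.ev a, ha, hs⟩

theorem infinite_of_infTrace {V : Set α} {P : Term α} (hP : ∀ n, FairUpTo V n P) {u : ℕ → α}
    (hu : InfTrace P u) : {n | u n ∈ V}.Infinite := by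
  obtain ⟨s, rfl, hs⟩ := hu
  have hreach : ∀ n, Reachable (s 0) (s n) := by
    intro n
    induction n with
    | zero => exact .refl
    | succ n ih => exact ih.trans (hs n).reachable
  intro hfin
  obtain ⟨N, hN⟩ := hfin.bddAbove
  -- Beyond position `N` the trace avoids `V`. Each weak step consists of one or more single steps,
  -- so accessibility is passed to the transitive closure.
  have hacc := ((fairUpTo_of_reachable hP (hreach (N + 1)) 1).acc one_ne_zero).transGen
  refine not_acc_of_seq (fun k => s (N + 1 + k)) (fun k => ?_) hacc
  refine (hs (N + 1 + k)).transGen fun hV => ?_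
  have := hN hV
  omega

theorem inter_nonempty_of_mem_ltsPairs [Finite α] {V : Set α} {P : Term α}
    (hP : ∀ n, FairUpTo V n P) {p : Set α × Set α} (hp : p ∈ ltsPairs P) :
    (p.1 ∩ V).Nonempty := by
  obtain ⟨-, hc, u, hu, -, hco⟩ := hp
  by_contra hempty
  refine infinite_of_infTrace hP hu ?_
  have : {n | u n ∈ V} = ⋃ b ∈ V, {n | u n = b} := by
    ext n
    simp
  rw [this]
  -- Finiteness of the alphabet is essential: finitely many events, each occurring finitely often,
  -- occur finitely often altogether.
  refine Set.Finite.biUnion V.toFinite fun b hb => hco b ?_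
  rw [hc]
  exact fun hb' => hempty ⟨b, hb', hb⟩

/-! ### Structurally finite-state processes -/

theorem livelockFlag_of_seqSFS {P : Term α} (hP : SeqSFS P) (h : ¬ CanDiverge P) :
    livelockFlag P = false := by
  obtain ⟨hs, hc⟩ := id hP
  cases hs with
  | var X => simp [Closed, fv] at hc
  | _ => simp [livelockFlag, *]

theorem fairCofair_of_seqSFS {P : Term α} (hP : SeqSFS P) : fairCofair P = ltsPairs P := by
  obtain ⟨hs, hc⟩ := id hP
  cases hs with
  | var X => simp [Closed, fv] at hc
  | _ => simp [fairCofair, *]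

theorem SFS.sound [Finite α] {P : Term α} (hP : SFS P) :
    ∀ {U V : Set α}, (U, V) ∈ fairSets P →
      livelockFlag P = false ∧ ∀ p ∈ fairCofair P, (p.1 ∩ V).Nonempty := by
  have sequential : ∀ {P : Term α}, SeqSFS P → ∀ {U V : Set α}, (U, V) ∈ fairSets P →
      livelockFlag P = false ∧ ∀ p ∈ fairCofair P, (p.1 ∩ V).Nonempty := by
    intro P hP U V h
    have hfair := fairUpTo_of_mem_fairSets hP h
    refine ⟨livelockFlag_of_seqSFS hP (not_canDiverge_of_fairUpTo hfair), fun p hp => ?_⟩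
    rw [fairCofair_of_seqSFS hP] at hp
    exact inter_nonempty_of_mem_ltsPairs hfair hp
  induction hP with
  | sequential hP hc => exact sequential ⟨hP, hc⟩
  | @pre a P _ ih =>
    intro U V h
    -- A term can be SFS by this rule and closed sequential as well; the flag and the pairs are then
    -- read off the transition system.
    by_cases hs : SeqSFS (Term.pre a P)
    · exact sequential hs h
    rw [fairSets] at h
    rw [livelockFlag, fairCofair, if_neg hs, if_neg hs]
    exact ih h
  | @intChoice P Q _ _ ihP ihQ =>
    intro U V h
    by_cases hs : SeqSFS (Term.intChoice P Q)
    · exact sequential hs h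
    rw [fairSets] at h
    rw [livelockFlag, fairCofair, if_neg hs, if_neg hs, (ihP h.1).1, (ihQ h.2).1]
    exact ⟨rfl, fun p hp => hp.elim ((ihP h.1).2 p) ((ihQ h.2).2 p)⟩
  | @extChoice P Q _ _ ihP ihQ =>
    intro U V h
    by_cases hs : SeqSFS (Term.extChoice P Q)
    · exact sequential hs h
    rw [fairSets] at h
    rw [livelockFlag, fairCofair, if_neg hs, if_neg hs, (ihP h.1).1, (ihQ h.2).1]
    exact ⟨rfl, fun p hp => hp.elim ((ihP h.1).2 p) ((ihQ h.2).2 p)⟩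
  | @seq P Q _ _ ihP ihQ =>
    intro U V h
    by_cases hs : SeqSFS (Term.seq P Q)
    · exact sequential hs h
    rw [fairSets] at h
    rw [livelockFlag, fairCofair, if_neg hs, if_neg hs, (ihP h.1).1, (ihQ h.2).1]
    exact ⟨rfl, fun p hp => hp.elim ((ihP h.1).2 p) ((ihQ h.2).2 p)⟩
  | @par A P Q _ _ ihP ihQ =>
    intro U V h
    rw [fairSets] at h
    rw [livelockFlag, fairCofair]
    rcases h with (h | ⟨U₁, U₂, V₁, h₁, h₂, he⟩) | ⟨U₁, U₂, V₂, h₂, h₁, he⟩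
    · obtain ⟨fP, hP⟩ := ihP h.1
      obtain ⟨fQ, hQ⟩ := ihQ h.2
      refine ⟨by simp [fP, fQ], ?_⟩
      rintro ⟨F, C⟩ ((⟨-, F₁, C₁, F₂, C₂, m₁, m₂, hF, -⟩ | hp) | hp)
      · obtain ⟨a, ha, haV⟩ := hP _ m₁
        exact ⟨a, hF ▸ Or.inl ha, haV⟩
      · exact hP _ hp.1
      · exact hQ _ hp.1
    · obtain ⟨fP, hP⟩ := ihP h₁
      obtain ⟨fQ, hQ⟩ := ihQ h₂
      obtain rfl : V = V₁ := congrArg Prod.snd he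
      refine ⟨by simp [fP, fQ], ?_⟩
      rintro ⟨F, C⟩ ((⟨-, F₁, C₁, F₂, C₂, m₁, m₂, hF, -⟩ | hp) | hp)
      · obtain ⟨a, ha, haV⟩ := hP _ m₁
        exact ⟨a, hF ▸ Or.inl ha, haV⟩
      · exact hP _ hp.1
      -- Here `(U₂, A)` is a fair pair of `Q`, so every pair of `Q` meets `A`; `Q` cannot run
      -- forever alone without synchronising.
      · exact absurd hp.2 (hQ _ hp.1).ne_empty
    · obtain ⟨fP, hP⟩ := ihP h₁
      obtain ⟨fQ, hQ⟩ := ihQ h₂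
      obtain rfl : V = V₂ := congrArg Prod.snd he
      refine ⟨by simp [fP, fQ], ?_⟩
      rintro ⟨F, C⟩ ((⟨-, F₁, C₁, F₂, C₂, m₁, m₂, hF, -⟩ | hp) | hp)
      · obtain ⟨a, ha, haV⟩ := hQ _ m₂
        exact ⟨a, hF ▸ Or.inr ha, haV⟩
      · exact absurd hp.2 (hP _ hp.1).ne_empty
      · exact hQ _ hp.1
  | @hide P _ A ih =>
    intro U V h
    by_cases hs : SeqSFS (Term.hide P A)
    · exact sequential hs h
    rw [fairSets] at h
    obtain ⟨V', h, hA, hV⟩ := h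
    obtain ⟨f, hP⟩ := ih h
    have key : ∀ p ∈ fairCofair P, ∃ a ∈ p.1 \ A, a ∈ V := by
      intro p hp
      obtain ⟨a, ha, haV⟩ := hP p hp
      exact ⟨a, ⟨ha, fun haA => hA.subset ⟨haV, haA⟩⟩, hV haV⟩
    rw [livelockFlag, fairCofair, if_neg hs, if_neg hs, if_pos]
    · refine ⟨rfl, ?_⟩
      rintro _ ⟨F, C, hp, rfl⟩
      exact key _ hp
    · exact ⟨f, fun p hp => let ⟨a, ha, _⟩ := key p hp; ⟨a, ha⟩⟩
  | @rename P _ R ih =>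
    intro U V h
    by_cases hs : SeqSFS (Term.rename P R)
    · exact sequential hs h
    rw [fairSets] at h
    obtain ⟨V', h, hV⟩ := h
    obtain ⟨f, hP⟩ := ih h
    rw [livelockFlag, fairCofair, if_neg hs, if_neg hs]
    refine ⟨f, ?_⟩
    rintro ⟨F, C⟩ ⟨F', C', hp, hF', -, -⟩
    obtain ⟨a, ha, haV⟩ := hP _ hp
    -- The clause `F' ⊆ relPreimage R F` carries the common element of `F'` and `V'` to one of `F`,
    -- which lies in `relImage R V' ⊆ V`.
    obtain ⟨b, hb, hab⟩ := hF' ha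
    exact ⟨b, hb, hV ⟨a, haV, hab⟩⟩

end Term

end CSP

theorem proposition6p2 {α : Type*} [Finite α] (P : CSP.Term α) (hP : P.SFS)
    (hF : P.fairSets.Nonempty) : P.livelockFlag = false := by
  obtain ⟨⟨U, V⟩, h⟩ := hF
  exact (hP.sound h).1
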